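/- Let $k$ be a field, let $q\in k$ with $q\neq 0$ and $q^2\neq 1$, let $n\ge 2$, and let $(a_{ij})_{1\le i,j\le n-1}$ be the Cartan matrix of $\mathfrak{sl}(n)$: $a_{ii}=2$, $a_{i,i\pm1}=-1$, and $a_{ij}=0$ otherwise. A type assignment gives each of the $2(n-1)$ symbols $E_1,\dots,E_{n-1},F_1,\dots,F_{n-1}$ a type, $1$ or $2$. Reading the $2(n-1)$ binary digits of an integer $0\le d<2^{2(n-1)}$, most significant first, as the types of $E_1,\dots,E_{n-1},F_1,\dots,F_{n-1}$ in this order (digit $1$ for type 1, digit $0$ for type 2) is a bijection between these integers and the type assignments, so there are $2^{2(n-1)}$ of them. For each such $d$ let $w\mathfrak{sl}^d_q(n)$ be the unital associative $k$-algebra with generators $E_i,F_i,K_i,\overline K_i$ ($1\le i\le n-1$) and the relations, for all $i,j$ unless restricted, $$K_iK_j=K_jK_i,\quad \overline K_i\overline K_j=\overline K_j\overline K_i,\quad K_i\overline K_j=\overline K_jK_i,\quad K_i\overline K_i=K_j\overline K_j=:J,$$ $$JK_j=K_jJ=K_j,\qquad J\overline K_j=\overline K_jJ=\overline K_j,\qquad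 E_iF_j-F_jE_i=\delta_{ij}\frac{K_i-\overline K_i}{q-q^{-1}},$$ $$X_i^2X_j-(q+q^{-1})X_iX_jX_i+X_jX_i^2=0\ \ (|i-j|=1),\qquad X_iX_j=X_jX_i\ \ (|i-j|\ge2),\qquad X\in\{E,F\},$$ together with, for each $i$, $$K_jE_i=q^{a_{ij}}E_iK_j,\quad E_i\overline K_j=q^{a_{ij}}\overline K_jE_i\quad\text{for all } j\qquad\text{if } E_i \text{ is of type 1},$$ $$K_jE_i\overline K_j=q^{a_{ij}}E_i\quad\text{for all } j\qquad\text{if } E_i \text{ is of type 2},$$ and the same relations with $F_i$ in place of $E_i$ and $-a_{ij}$ in place of $a_{ij}$, according to the type of $F_i$. Then, for every $d$, there are algebra homomorphisms $\Delta:w\mathfrak{sl}^d_q(n)\to w\mathfrak{sl}^d_q(n)\otimes w\mathfrak{sl}^d_q(n)$ and $\varepsilon:w\mathfrak{sl}^d_q(n)\to k$ with $$\Delta(K_i)=K_i\otimes K_i,\qquad \Delta(\overline K_i)=\overline K_i\otimes\overline K_i,$$ $$\Delta(E_i)=\begin{cases}1\otimes E_i+E_i\otimes K_i,& E_i\text{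 of type 1},\\ J\otimes E_i+E_i\otimes K_i,& E_i\text{ of type 2},\end{cases}\qquad \Delta(F_i)=\begin{cases}F_i\otimes 1+\overline K_i\otimes F_i,& F_i\text{ of type 1},\\ F_i\otimes J+\overline K_i\otimes F_i,& F_i\text{ of type 2},\end{cases}$$ $$\varepsilon(K_i)=\varepsilon(\overline K_i)=1,\qquad \varepsilon(E_i)=\varepsilon(F_i)=0,$$ and they make $w\mathfrak{sl}^d_q(n)$ a bialgebra. Moreover, whatever the types are, there is a $k$-linear unital algebra anti-homomorphism $T:w\mathfrak{sl}^d_q(n)\to w\mathfrak{sl}^d_q(n)$ with $$T(K_i)=\overline K_i,\qquad T(\overline K_i)=K_i,\qquad T(E_i)=-E_i\overline K_i,\qquad T(F_i)=-K_iF_i,$$ and $T$ is a weak antipode: $T*\mathrm{id}*T=T$ and $\mathrm{id}*T*\mathrm{id}=\mathrm{id}$, where $a*b=m\circ(a\otimes b)\circ\Delta$ and $m$ is the multiplication. -/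

import Mathlib

open scoped TensorProduct

/-! ### Bialgebras and weak antipodes -/

section WeakHopf

variable {k H : Type*} [Field k] [Ring H] [Algebra k H]

/-- `(H, Δ, ε)` is a bialgebra: `Δ` and `ε` are algebra homomorphisms, `Δ` is coassociative and
`ε` is a two-sided counit for `Δ`. -/
structure IsBialgebra (Δ : H →ₐ[k] H ⊗[k] H) (ε : H →ₐ[k] k) : Prop where
  coassoc : (Algebra.TensorProduct.assoc k k k H H H).toAlgHom.comp
      ((Algebra.TensorProduct.map Δ (.id k H)).comp Δ)
      = (Algebra.TensorProduct.map (.id k H) Δ).comp Δ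
  counit_left : (Algebra.TensorProduct.map ε (.id k H)).comp Δ
      = (Algebra.TensorProduct.lid k H).symm
  counit_right : (Algebra.TensorProduct.map (.id k H) ε).comp Δ
      = (Algebra.TensorProduct.rid k k H).symm

/-- The data of `IsBialgebra` give a `Bialgebra` in the sense of Mathlib. -/
abbrev IsBialgebra.toBialgebra {Δ : H →ₐ[k] H ⊗[k] H} {ε : H →ₐ[k] k} (h : IsBialgebra Δ ε) :
    Bialgebra k H :=
  Bialgebra.ofAlgHom Δ ε h.coassoc h.counit_left h.counit_right

/-- The convolution product `a * b = m ∘ (a ⊗ b) ∘ Δ` of linear endomaps of `H`. -/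
noncomputable def convolution (Δ : H →ₐ[k] H ⊗[k] H) (a b : H →ₗ[k] H) : H →ₗ[k] H :=
  LinearMap.mul' k H ∘ₗ TensorProduct.map a b ∘ₗ Δ.toLinearMap

/-- `T` is a weak antipode: a unital algebra anti-homomorphism with `T * id * T = T` and
`id * T * id = id` for the convolution product. -/
structure IsWeakAntipode (Δ : H →ₐ[k] H ⊗[k] H) (T : H →ₗ[k] H) : Prop where
  map_one : T 1 = 1
  map_mul : ∀ x y : H, T (x * y) = T y * T x
  conv_T_id_T : convolution Δ (convolution Δ T LinearMap.id) T = T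
  conv_id_T_id : convolution Δ (convolution Δ LinearMap.id T) LinearMap.id = LinearMap.id

end WeakHopf

/-! ### The algebras `wsl_q^d(n)` -/

namespace WSl

/-- The generators; the index `i : Fin (n - 1)` stands for the simple root number `i + 1`. -/
inductive Gen (n : ℕ) : Type
  | E (i : Fin (n - 1))
  | F (i : Fin (n - 1))
  | K (i : Fin (n - 1))
  | Kbar (i : Fin (n - 1))

/-- The Cartan matrix of `sl(n)`. -/
abbrev cartan {n : ℕ} (i j : Fin (n - 1)) : ℤ := CartanMatrix.A (n - 1) i j

/-- A choice of type for each of the `2(n-1)` generators `E_i` (left summand) and `F_i` (right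
summand): `true` is type 1 and `false` is type 2. -/
abbrev TypeAssignment (n : ℕ) : Type := Fin (n - 1) ⊕ Fin (n - 1) → Bool

/-- The type assignment coded by an integer `0 ≤ d < 2^(2(n-1))`: its `2(n-1)` binary digits,
the most significant one first, are the types of `E_1, …, E_{n-1}, F_1, …, F_{n-1}` in this order,
the digit `1` meaning type 1 and the digit `0` meaning type 2. -/
def typesOf (n : ℕ) (d : Fin (2 ^ (2 * (n - 1)))) : TypeAssignment n
  | .inl i => (d : ℕ).testBit (2 * (n - 1) - 1 - i)
  | .inr i => (d : ℕ).testBit (n - 1 - 1 - i)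

section Relations

variable (k : Type*) [Field k] (n : ℕ)

/-- The generator `E_i` in the free algebra. -/
abbrev fE (i : Fin (n - 1)) : FreeAlgebra k (Gen n) := FreeAlgebra.ι k (Gen.E i)
/-- The generator `F_i` in the free algebra. -/
abbrev fF (i : Fin (n - 1)) : FreeAlgebra k (Gen n) := FreeAlgebra.ι k (Gen.F i)
/-- The generator `K_i` in the free algebra. -/
abbrev fK (i : Fin (n - 1)) : FreeAlgebra k (Gen n) := FreeAlgebra.ι k (Gen.K i)
/-- The generator `K̄_i` in the free algebra. -/
abbrev fKbar (i : Fin (n - 1)) : FreeAlgebra k (Gen n) := FreeAlgebra.ι k (Gen.Kbar i)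
/-- The product `K_i K̄_i` in the free algebra; the relation `J_eq` below makes it independent
of `i`, and its common value in the quotient is `J`. -/
abbrev fJ (i : Fin (n - 1)) : FreeAlgebra k (Gen n) := fK k n i * fKbar k n i

/-- The defining relations of `wsl_q^d(n)`. -/
inductive Rel (q : k) (d : TypeAssignment n) :
    FreeAlgebra k (Gen n) → FreeAlgebra k (Gen n) → Prop
  | K_comm (i j) : Rel q d (fK k n i * fK k n j) (fK k n j * fK k n i)
  | Kbar_comm (i j) : Rel q d (fKbar k n i * fKbar k n j) (fKbar k n j * fKbar k n i)
  | K_Kbar_comm (i j) : Rel q d (fK k n i * fKbar k n j) (fKbar k n j * fK k n i)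
  | J_eq (i j) : Rel q d (fJ k n i) (fJ k n j)
  | J_K (i j) : Rel q d (fJ k n i * fK k n j) (fK k n j)
  | K_J (i j) : Rel q d (fK k n j * fJ k n i) (fK k n j)
  | J_Kbar (i j) : Rel q d (fJ k n i * fKbar k n j) (fKbar k n j)
  | Kbar_J (i j) : Rel q d (fKbar k n j * fJ k n i) (fKbar k n j)
  | EF_same (i) : Rel q d (fE k n i * fF k n i - fF k n i * fE k n i)
      ((q - q⁻¹)⁻¹ • (fK k n i - fKbar k n i))
  | EF_diff (i j) (h : i ≠ j) : Rel q d (fE k n i * fF k n j - fF k n j * fE k n i) 0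
  | serreE (i j : Fin (n - 1)) (h : (i : ℕ) + 1 = j ∨ (j : ℕ) + 1 = i) :
      Rel q d (fE k n i ^ 2 * fE k n j - (q + q⁻¹) • (fE k n i * fE k n j * fE k n i)
        + fE k n j * fE k n i ^ 2) 0
  | serreF (i j : Fin (n - 1)) (h : (i : ℕ) + 1 = j ∨ (j : ℕ) + 1 = i) :
      Rel q d (fF k n i ^ 2 * fF k n j - (q + q⁻¹) • (fF k n i * fF k n j * fF k n i)
        + fF k n j * fF k n i ^ 2) 0
  | E_comm (i j : Fin (n - 1)) (h : (i : ℕ) + 2 ≤ j ∨ (j : ℕ) + 2 ≤ i) :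
      Rel q d (fE k n i * fE k n j) (fE k n j * fE k n i)
  | F_comm (i j : Fin (n - 1)) (h : (i : ℕ) + 2 ≤ j ∨ (j : ℕ) + 2 ≤ i) :
      Rel q d (fF k n i * fF k n j) (fF k n j * fF k n i)
  | E_type1_K (i j) (h : d (.inl i) = true) :
      Rel q d (fK k n j * fE k n i) (q ^ cartan i j • (fE k n i * fK k n j))
  | E_type1_Kbar (i j) (h : d (.inl i) = true) :
      Rel q d (fE k n i * fKbar k n j) (q ^ cartan i j • (fKbar k n j * fE k n i))
  | E_type2 (i j) (h : d (.inl i) = false) :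
      Rel q d (fK k n j * fE k n i * fKbar k n j) (q ^ cartan i j • fE k n i)
  | F_type1_K (i j) (h : d (.inr i) = true) :
      Rel q d (fK k n j * fF k n i) (q ^ (-cartan i j) • (fF k n i * fK k n j))
  | F_type1_Kbar (i j) (h : d (.inr i) = true) :
      Rel q d (fF k n i * fKbar k n j) (q ^ (-cartan i j) • (fKbar k n j * fF k n i))
  | F_type2 (i j) (h : d (.inr i) = false) :
      Rel q d (fK k n j * fF k n i * fKbar k n j) (q ^ (-cartan i j) • fF k n i)

end Relations

/-- The unital associative `k`-algebra `wsl_q^d(n)` presented by the generators `Gen n` and the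
relations `Rel k n q d`. -/
abbrev Alg (k : Type*) [Field k] (q : k) (n : ℕ) (d : TypeAssignment n) : Type _ :=
  RingQuot (Rel k n q d)

section Generators

variable {k : Type*} [Field k] {q : k} {n : ℕ} {d : TypeAssignment n}

/-- The image of a generator in `wsl_q^d(n)`. -/
noncomputable def gen (x : Gen n) : Alg k q n d :=
  RingQuot.mkAlgHom k (Rel k n q d) (FreeAlgebra.ι k x)

/-- `E_i`. -/
noncomputable abbrev E (i : Fin (n - 1)) : Alg k q n d := gen (.E i)
/-- `F_i`. -/
noncomputable abbrev F (i : Fin (n - 1)) : Alg k q n d := gen (.F i)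
/-- `K_i`. -/
noncomputable abbrev K (i : Fin (n - 1)) : Alg k q n d := gen (.K i)
/-- `K̄_i`. -/
noncomputable abbrev Kbar (i : Fin (n - 1)) : Alg k q n d := gen (.Kbar i)
/-- `J = K_i K̄_i`, which does not depend on `i`. -/
noncomputable abbrev J (i : Fin (n - 1)) : Alg k q n d := K i * Kbar i

/-- The prescribed values of the coproduct on the generators. -/
structure IsCoproduct (Δ : Alg k q n d →ₐ[k] Alg k q n d ⊗[k] Alg k q n d) : Prop where
  comul_K : ∀ i, Δ (K i) = K i ⊗ₜ[k] K i
  comul_Kbar : ∀ i, Δ (Kbar i) = Kbar i ⊗ₜ[k] Kbar i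
  comul_E_type1 : ∀ i, d (.inl i) = true → Δ (E i) = 1 ⊗ₜ[k] E i + E i ⊗ₜ[k] K i
  comul_E_type2 : ∀ i, d (.inl i) = false → Δ (E i) = J i ⊗ₜ[k] E i + E i ⊗ₜ[k] K i
  comul_F_type1 : ∀ i, d (.inr i) = true → Δ (F i) = F i ⊗ₜ[k] 1 + Kbar i ⊗ₜ[k] F i
  comul_F_type2 : ∀ i, d (.inr i) = false → Δ (F i) = F i ⊗ₜ[k] J i + Kbar i ⊗ₜ[k] F i

/-- The prescribed values of the counit on the generators. -/
structure IsCounit (ε : Alg k q n d →ₐ[k] k) : Prop where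
  counit_K : ∀ i, ε (K i) = 1
  counit_Kbar : ∀ i, ε (Kbar i) = 1
  counit_E : ∀ i, ε (E i) = 0
  counit_F : ∀ i, ε (F i) = 0

/-- The prescribed values of the weak antipode on the generators. -/
structure IsAntipodeOnGenerators (T : Alg k q n d →ₗ[k] Alg k q n d) : Prop where
  apply_K : ∀ i, T (K i) = Kbar i
  apply_Kbar : ∀ i, T (Kbar i) = K i
  apply_E : ∀ i, T (E i) = -(E i * Kbar i)
  apply_F : ∀ i, T (F i) = -(K i * F i)

end Generators

end WSl

/-!
Write `φ = id * T`. On the generators, `φ(K_i) = φ(K̄_i) = J`, `φ(E_i) = 0` and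
`φ(F_i) = (1 - J) F_i`. These values commute with all `E_j`, `K_j`, `K̄_j` and `J F_j`, hence with
the image of `T`, and this makes `φ` multiplicative: `φ(xy) = x₁ φ(y) T(x₂) = φ(x) φ(y)`.
For the same reason the elements satisfying `T * φ = T` are closed under products, and so are those
satisfying the strengthening `∑ φ(x₁) z x₂ = x z`, for all `z` commuting with the above elements, of
`φ * id = id`. Both identities therefore only need to be checked on the generators, and
`T * φ = (T * id) * T` by coassociativity.

For `Δ` and `T` to respect the relations, the two types can be treated at once: a type 2 relation
for `X` says that `X` satisfies the type 1 relations and `J X = X`. The generators `E_i` and `F_i`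
are exchanged by swapping `K` with `K̄` and `q` with `q⁻¹`.
-/

section TensorSquare

variable {R C D A : Type*} [CommSemiring R] [Semiring C] [Algebra R C] [Semiring D] [Algebra R D]
  [Semiring A] [Algebra R A]

theorem mul'_map_mul_of_map_mul_of_map_mul_rev {f : C →ₗ[R] A} {g : D →ₗ[R] A}
    (hf : ∀ x y, f (x * y) = f x * f y) (hg : ∀ x y, g (x * y) = g y * g x) (t : C ⊗[R] D)
    {s : C ⊗[R] D} (hs : ∀ y, Commute (LinearMap.mul' R A (TensorProduct.map f g s)) (g y)) :
    LinearMap.mul' R A (TensorProduct.map f g (t * s)) =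
      LinearMap.mul' R A (TensorProduct.map f g t) *
        LinearMap.mul' R A (TensorProduct.map f g s) := by
  have tmul_mul (x : C) (y : D) (s : C ⊗[R] D) :
      LinearMap.mul' R A (TensorProduct.map f g (x ⊗ₜ y * s)) =
        f x * LinearMap.mul' R A (TensorProduct.map f g s) * g y := by
    induction s with
    | zero => simp
    | tmul a b => simp [hf, hg, mul_assoc]
    | add s₁ s₂ h₁ h₂ => simp only [mul_add, add_mul, map_add, h₁, h₂]
  induction t with
  | zero => simp
  | tmul x y => simp only [tmul_mul, TensorProduct.map_tmul, LinearMap.mul'_apply, mul_assoc,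
      (hs y).eq]
  | add t₁ t₂ h₁ h₂ => simp only [add_mul, map_add, h₁, h₂]

theorem mul'_map_mul_of_map_mul_rev_of_map_mul {f : C →ₗ[R] A} {g : D →ₗ[R] A}
    (hf : ∀ x y, f (x * y) = f y * f x) (hg : ∀ x y, g (x * y) = g x * g y) {t : C ⊗[R] D}
    (ht : ∀ y, Commute (g y) (LinearMap.mul' R A (TensorProduct.map f g t))) (s : C ⊗[R] D) :
    LinearMap.mul' R A (TensorProduct.map f g (t * s)) =
      LinearMap.mul' R A (TensorProduct.map f g s) *
        LinearMap.mul' R A (TensorProduct.map f g t) := by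
  have mul_tmul (t : C ⊗[R] D) (x : C) (y : D) :
      LinearMap.mul' R A (TensorProduct.map f g (t * x ⊗ₜ y)) =
        f x * LinearMap.mul' R A (TensorProduct.map f g t) * g y := by
    induction t with
    | zero => simp
    | tmul a b => simp [hf, hg, mul_assoc]
    | add t₁ t₂ h₁ h₂ => simp only [mul_add, add_mul, map_add, h₁, h₂]
  induction s with
  | zero => simp
  | tmul x y => simp only [mul_tmul, TensorProduct.map_tmul, LinearMap.mul'_apply, mul_assoc,
      (ht y).eq]
  | add s₁ s₂ h₁ h₂ => simp only [add_mul, mul_add, map_add, h₁, h₂]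

theorem mul'_map_mulLeft_mul {f : C →ₗ[R] A} (hf : ∀ x y, f (x * y) = f x * f y)
    {t : C ⊗[R] A} {x z : A}
    (ht : ∀ c, LinearMap.mul' R A (TensorProduct.map f (LinearMap.mulLeft R (f c * z)) t) =
      x * (f c * z)) (s : C ⊗[R] A) :
    LinearMap.mul' R A (TensorProduct.map f (LinearMap.mulLeft R z) (t * s)) =
      x * LinearMap.mul' R A (TensorProduct.map f (LinearMap.mulLeft R z) s) := by
  have mul_tmul (t : C ⊗[R] A) (c : C) (a : A) :
      LinearMap.mul' R A (TensorProduct.map f (LinearMap.mulLeft R z) (t * c ⊗ₜ a)) =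
        LinearMap.mul' R A (TensorProduct.map f (LinearMap.mulLeft R (f c * z)) t) * a := by
    induction t with
    | zero => simp
    | tmul => simp [hf, mul_assoc]
    | add t₁ t₂ h₁ h₂ => simp only [add_mul, map_add, h₁, h₂]
  induction s with
  | zero => simp
  | tmul c a => rw [mul_tmul, ht]; simp [mul_assoc]
  | add s₁ s₂ h₁ h₂ => simp only [mul_add, map_add, h₁, h₂]

end TensorSquare

section Generators

variable {R A : Type*} [CommSemiring R] [Semiring A] [Algebra R A] {S : Set A}

theorem forall_of_adjoin_eq_top (hS : Algebra.adjoin R S = ⊤) {p : A → Prop}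
    (mem : ∀ s ∈ S, p s) (one : p 1) (smul : ∀ (r : R) x, p x → p (r • x))
    (add : ∀ x y, p x → p y → p (x + y)) (mul : ∀ x y, p x → p y → p (x * y)) (x : A) : p x := by
  have hx : x ∈ Algebra.adjoin R S := hS ▸ Algebra.mem_top
  induction hx using Algebra.adjoin_induction with
  | mem x hx => exact mem x hx
  | algebraMap r => exact Algebra.algebraMap_eq_smul_one (A := A) r ▸ smul r 1 one
  | add x y _ _ hx hy => exact add x y hx hy
  | mul x y _ _ hx hy => exact mul x y hx hy

theorem commute_of_adjoin_eq_top (hS : Algebra.adjoin R S = ⊤) {T : A →ₗ[R] A}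
    (T_one : T 1 = 1) (T_mul : ∀ x y, T (x * y) = T y * T x) {z : A}
    (hz : ∀ s ∈ S, Commute z (T s)) (x : A) :
    Commute z (T x) := by
  induction x using forall_of_adjoin_eq_top hS with
  | mem s hs => exact hz s hs
  | one => rw [T_one]; exact Commute.one_right z
  | smul r x hx => exact map_smul T r x ▸ hx.smul_right r
  | add x y hx hy => exact map_add T x y ▸ hx.add_right hy
  | mul x y hx hy => exact T_mul x y ▸ hy.mul_right hx

end Generators

section WeakAntipode

variable {k H : Type*} [Field k] [Ring H] [Algebra k H] {Δ : H →ₐ[k] H ⊗[k] H} {ε : H →ₐ[k] k}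

theorem convolution_assoc (h : IsBialgebra Δ ε) (a b c : H →ₗ[k] H) :
    convolution Δ (convolution Δ a b) c = convolution Δ a (convolution Δ b c) :=
  letI := h.toBialgebra
  WithConv.toConv_injective
    (mul_assoc (WithConv.toConv a) (WithConv.toConv b) (WithConv.toConv c))

theorem convolution_apply (a b : H →ₗ[k] H) (x : H) :
    convolution Δ a b x = LinearMap.mul' k H (TensorProduct.map a b (Δ x)) :=
  rfl

theorem convolution_one (a b : H →ₗ[k] H) : convolution Δ a b 1 = a 1 * b 1 := by
  simp [convolution, Algebra.TensorProduct.one_def]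

theorem convolution_id_mul {T : H →ₗ[k] H} (T_mul : ∀ x y, T (x * y) = T y * T x) (x : H)
    {y : H} (hy : ∀ c, Commute (convolution Δ LinearMap.id T y) (T c)) :
    convolution Δ LinearMap.id T (x * y) =
      convolution Δ LinearMap.id T x * convolution Δ LinearMap.id T y := by
  simp only [convolution_apply, map_mul] at hy ⊢
  exact mul'_map_mul_of_map_mul_of_map_mul_rev (fun _ _ => rfl) T_mul (Δ x) hy

variable {T φ : H →ₗ[k] H} {S : Set H} {Z : Subalgebra k H}

theorem convolution_id_mem_of_adjoin_eq_top (hS : Algebra.adjoin k S = ⊤) (T_one : T 1 = 1)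
    (T_mul : ∀ x y, T (x * y) = T y * T x) (hZ : ∀ z ∈ Z, ∀ x, Commute z (T x))
    (hφ : ∀ s ∈ S, convolution Δ LinearMap.id T s ∈ Z) (x : H) :
    convolution Δ LinearMap.id T x ∈ Z := by
  induction x using forall_of_adjoin_eq_top hS with
  | mem s hs => exact hφ s hs
  | one => simp [convolution_one, T_one]
  | smul r x hx => exact map_smul (convolution Δ LinearMap.id T) r x ▸ Z.smul_mem hx r
  | add x y hx hy => exact map_add (convolution Δ LinearMap.id T) x y ▸ Z.add_mem hx hy
  | mul x y hx hy => exact convolution_id_mul T_mul x (hZ _ hy) ▸ Z.mul_mem hx hy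

theorem convolution_eq_left_of_adjoin_eq_top (hS : Algebra.adjoin k S = ⊤) (T_one : T 1 = 1)
    (T_mul : ∀ x y, T (x * y) = T y * T x) (φ_one : φ 1 = 1)
    (φ_mul : ∀ x y, φ (x * y) = φ x * φ y) (hφT : ∀ x y, Commute (φ x) (T y))
    (hTφ : ∀ s ∈ S, convolution Δ T φ s = T s) : convolution Δ T φ = T := by
  ext x
  induction x using forall_of_adjoin_eq_top hS with
  | mem s hs => exact hTφ s hs
  | one => simp [convolution_one, T_one, φ_one]
  | smul r x hx => simp only [map_smul, hx]
  | add x y hx hy => simp only [map_add, hx, hy]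
  | mul x y hx hy =>
    rw [T_mul, ← hx, ← hy]
    simp only [convolution_apply, map_mul] at hx ⊢
    exact mul'_map_mul_of_map_mul_rev_of_map_mul T_mul φ_mul (fun c => hx ▸ hφT c x) (Δ y)

/- The element `z` is what makes the induction work: in `φ(x₁y₁) x₂y₂ = φ(x₁) φ(y₁) x₂ y₂` the
factor `φ(y₁)` stands between `φ(x₁)` and `x₂`. -/
theorem convolution_mulLeft_of_adjoin_eq_top (hS : Algebra.adjoin k S = ⊤) (φ_one : φ 1 = 1)
    (φ_mul : ∀ x y, φ (x * y) = φ x * φ y) (φ_mem : ∀ x, φ x ∈ Z)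
    (hφ : ∀ s ∈ S, ∀ z ∈ Z, convolution Δ φ (LinearMap.mulLeft k z) s = s * z) (x : H) :
    ∀ z ∈ Z, convolution Δ φ (LinearMap.mulLeft k z) x = x * z := by
  induction x using forall_of_adjoin_eq_top hS with
  | mem s hs => exact hφ s hs
  | one => simp [convolution_one, φ_one]
  | smul r x hx => intro z hz; simp only [map_smul, hx z hz, smul_mul_assoc]
  | add x y hx hy => intro z hz; simp only [map_add, hx z hz, hy z hz, add_mul]
  | mul x y hx hy =>
    intro z hz
    rw [mul_assoc, ← hy z hz, convolution_apply, map_mul]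
    exact mul'_map_mulLeft_mul φ_mul (fun c => hx _ (Z.mul_mem (φ_mem c) hz)) (Δ y)

theorem isWeakAntipode_of_adjoin_eq_top (h : IsBialgebra Δ ε) (hS : Algebra.adjoin k S = ⊤)
    (T_one : T 1 = 1) (T_mul : ∀ x y, T (x * y) = T y * T x)
    (hZ : ∀ z ∈ Z, ∀ s ∈ S, Commute z (T s))
    (hφ : ∀ s ∈ S, convolution Δ LinearMap.id T s ∈ Z)
    (hTφ : ∀ s ∈ S, convolution Δ T (convolution Δ LinearMap.id T) s = T s)
    (hφz : ∀ s ∈ S, ∀ z ∈ Z,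
      convolution Δ (convolution Δ LinearMap.id T) (LinearMap.mulLeft k z) s = s * z) :
    IsWeakAntipode Δ T := by
  set φ := convolution Δ LinearMap.id T with φ_def
  have commute_T : ∀ z ∈ Z, ∀ x, Commute z (T x) := fun z hz =>
    commute_of_adjoin_eq_top hS T_one T_mul (hZ z hz)
  have φ_mem : ∀ x, φ x ∈ Z :=
    convolution_id_mem_of_adjoin_eq_top hS T_one T_mul commute_T hφ
  have φ_one : φ 1 = 1 := by simp [φ_def, convolution_one, T_one]
  have φ_mul (x y) : φ (x * y) = φ x * φ y := convolution_id_mul T_mul x (commute_T _ (φ_mem y))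
  refine ⟨T_one, T_mul, ?_, ?_⟩
  · rw [convolution_assoc h]
    exact convolution_eq_left_of_adjoin_eq_top hS T_one T_mul φ_one φ_mul
      (fun x => commute_T _ (φ_mem x)) hTφ
  · ext x
    simpa using convolution_mulLeft_of_adjoin_eq_top hS φ_one φ_mul φ_mem hφz x 1 Z.one_mem

end WeakAntipode

namespace WSl

section SerrePair

variable {R B C : Type*} [CommRing R] [Ring B] [Algebra R B] [Ring C] [Algebra R C]

/-- The quantum Serre relation `x²y - c xyx + yx² = 0`, with `c = p + p⁻¹` in the applications. -/
def IsSerrePair (c : R) (x y : B) : Prop :=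
  x ^ 2 * y - c • (x * y * x) + y * x ^ 2 = 0

variable {c : R} {x y : B}

theorem IsSerrePair.map (h : IsSerrePair c x y) (f : B →ₐ[R] C) : IsSerrePair c (f x) (f y) := by
  simpa [IsSerrePair] using congrArg f h

theorem IsSerrePair.op (h : IsSerrePair c x y) :
    IsSerrePair c (MulOpposite.op x) (MulOpposite.op y) := by
  have h := congrArg MulOpposite.op h
  simp only [MulOpposite.op_add, MulOpposite.op_sub, MulOpposite.op_mul, MulOpposite.op_smul,
    MulOpposite.op_pow, MulOpposite.op_zero, mul_assoc] at h
  rw [IsSerrePair, ← h]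
  simp only [mul_assoc]
  abel

theorem IsSerrePair.tmul_left (h : IsSerrePair c x y) {u v : C} (huv : Commute u v) :
    IsSerrePair c (u ⊗ₜ[R] x) (v ⊗ₜ[R] y) := by
  have huvu : u * v * u = u ^ 2 * v := by rw [mul_assoc, ← huv.eq, sq, mul_assoc]
  have hvuu : v * u ^ 2 = u ^ 2 * v := (huv.pow_left 2).eq.symm
  simp only [IsSerrePair, Algebra.TensorProduct.tmul_pow, Algebra.TensorProduct.tmul_mul_tmul,
    huvu, hvuu, ← TensorProduct.tmul_smul, ← TensorProduct.tmul_sub, ← TensorProduct.tmul_add]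
  rw [h, TensorProduct.tmul_zero]

theorem IsSerrePair.tmul_right (h : IsSerrePair c x y) {u v : C} (huv : Commute u v) :
    IsSerrePair c (x ⊗ₜ[R] u) (y ⊗ₜ[R] v) := by
  simpa using (h.tmul_left huv).map (Algebra.TensorProduct.comm R C B).toAlgHom

theorem IsSerrePair.mul (h : IsSerrePair c x y) {s t : B} {a b : R} (hst : Commute s t)
    (hsx : s * x = a • (x * s)) (hsy : s * y = b • (y * s)) (htx : t * x = b • (x * t)) :
    IsSerrePair c (x * s) (y * t) := by
  have hsx' (z) : s * (x * z) = a • (x * (s * z)) := by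
    rw [← mul_assoc, hsx, smul_mul_assoc, mul_assoc]
  have hsy' (z) : s * (y * z) = b • (y * (s * z)) := by
    rw [← mul_assoc, hsy, smul_mul_assoc, mul_assoc]
  have htx' (z) : t * (x * z) = b • (x * (t * z)) := by
    rw [← mul_assoc, htx, smul_mul_assoc, mul_assoc]
  have hts : t * s = s * t := hst.eq.symm
  have hts' (z) : t * (s * z) = s * (t * z) := by rw [← mul_assoc, hts, mul_assoc]
  have h := congrArg (fun z => (a * b ^ 2) • (z * (s * (s * t)))) h
  simp only [zero_mul, smul_zero] at h
  rw [IsSerrePair, ← h]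
  simp only [sq, mul_assoc, add_mul, sub_mul, hsx', hsy', htx', hts, hts', mul_smul_comm,
    smul_mul_assoc]
  module

end SerrePair

theorem IsSerrePair.add {k B : Type*} [Field k] [Ring B] [Algebra k B] {p : k} (hp : p ≠ 0)
    {x y x' y' : B} (h : IsSerrePair (p + p⁻¹) x y) (h' : IsSerrePair (p + p⁻¹) x' y')
    (hxx : x' * x = p ^ 2 • (x * x')) (hxy : x' * y = p⁻¹ • (y * x'))
    (hyx : y' * x = p⁻¹ • (x * y')) : IsSerrePair (p + p⁻¹) (x + x') (y + y') := by
  have hxx' (z) : x' * (x * z) = p ^ 2 • (x * (x' * z)) := by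
    rw [← mul_assoc, hxx, smul_mul_assoc, mul_assoc]
  have hxy' (z) : x' * (y * z) = p⁻¹ • (y * (x' * z)) := by
    rw [← mul_assoc, hxy, smul_mul_assoc, mul_assoc]
  have hyx' (z) : y' * (x * z) = p⁻¹ • (x * (y' * z)) := by
    rw [← mul_assoc, hyx, smul_mul_assoc, mul_assoc]
  simp only [IsSerrePair, sq, mul_assoc, add_mul, mul_add, hxx, hxy, hyx, hxx', hxy', hyx',
    mul_smul_comm, smul_mul_assoc] at h h' ⊢
  refine Eq.trans ?_ ((congrArg₂ (· + ·) h h').trans (add_zero 0))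
  match_scalars <;> field_simp <;> ring

section Torus

variable {k ι B : Type*} [CommSemiring k] [Semiring B] [Algebra k B] {K Kb : ι → B}

/-- The relations among the `K i` and `Kb i` (which stands for `K̄ i`): they commute, and the
products `J = K i * Kb i` agree and act as a unit on them. -/
structure IsTorus (K Kb : ι → B) : Prop where
  K_comm : ∀ i j, Commute (K i) (K j)
  Kb_comm : ∀ i j, Commute (Kb i) (Kb j)
  K_Kb_comm : ∀ i j, Commute (K i) (Kb j)
  J_eq : ∀ i j, K i * Kb i = K j * Kb j
  J_mul_K : ∀ i j, K i * Kb i * K j = K j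
  J_mul_Kb : ∀ i j, K i * Kb i * Kb j = Kb j

namespace IsTorus

theorem swap (h : IsTorus K Kb) : IsTorus Kb K where
  K_comm := h.Kb_comm
  Kb_comm := h.K_comm
  K_Kb_comm i j := (h.K_Kb_comm j i).symm
  J_eq i j := by rw [← (h.K_Kb_comm i i).eq, ← (h.K_Kb_comm j j).eq, h.J_eq i j]
  J_mul_K i j := by rw [← (h.K_Kb_comm i i).eq, h.J_mul_Kb]
  J_mul_Kb i j := by rw [← (h.K_Kb_comm i i).eq, h.J_mul_K]

theorem commute_J_K (h : IsTorus K Kb) (i j : ι) : Commute (K i * Kb i) (K j) :=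
  (h.K_comm i j).mul_left (h.K_Kb_comm j i).symm

theorem commute_J_Kb (h : IsTorus K Kb) (i j : ι) : Commute (K i * Kb i) (Kb j) :=
  (h.K_Kb_comm i j).mul_left (h.Kb_comm i j)

theorem K_mul_J (h : IsTorus K Kb) (i j : ι) : K j * (K i * Kb i) = K j :=
  (h.commute_J_K i j).eq ▸ h.J_mul_K i j

theorem Kb_mul_J (h : IsTorus K Kb) (i j : ι) : Kb j * (K i * Kb i) = Kb j :=
  (h.commute_J_Kb i j).eq ▸ h.J_mul_Kb i j

theorem isIdempotentElem_J (h : IsTorus K Kb) (i : ι) : IsIdempotentElem (K i * Kb i) := by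
  rw [IsIdempotentElem, ← mul_assoc, h.J_mul_K]

theorem op_swap (h : IsTorus K Kb) :
    IsTorus (fun i => MulOpposite.op (Kb i)) (fun i => MulOpposite.op (K i)) where
  K_comm i j := (h.Kb_comm i j).op
  Kb_comm i j := (h.K_comm i j).op
  K_Kb_comm i j := (h.K_Kb_comm j i).symm.op
  J_eq i j := congrArg MulOpposite.op (h.J_eq i j)
  J_mul_K i j := congrArg MulOpposite.op (h.Kb_mul_J i j)
  J_mul_Kb i j := congrArg MulOpposite.op (h.K_mul_J i j)

theorem tmul_self (h : IsTorus K Kb) :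
    IsTorus (fun i => K i ⊗ₜ[k] K i) (fun i => Kb i ⊗ₜ[k] Kb i) where
  K_comm i j := (h.K_comm i j).tmul (h.K_comm i j)
  Kb_comm i j := (h.Kb_comm i j).tmul (h.Kb_comm i j)
  K_Kb_comm i j := (h.K_Kb_comm i j).tmul (h.K_Kb_comm i j)
  J_eq i j := by simp only [Algebra.TensorProduct.tmul_mul_tmul, h.J_eq i j]
  J_mul_K i j := by simp only [Algebra.TensorProduct.tmul_mul_tmul, h.J_mul_K i j]
  J_mul_Kb i j := by simp only [Algebra.TensorProduct.tmul_mul_tmul, h.J_mul_Kb i j]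

end IsTorus

end Torus

section RootFamily

variable {k ι B C : Type*} [Field k] [Ring B] [Algebra k B] [Ring C] [Algebra k C]
  {A : Matrix ι ι ℤ} {p : k} {X K Kb : ι → B}

/-- `X i` is a root vector of weight `p ^ A i j` for `K j` and `Kb j`, and the `X i` satisfy the
quantum Serre relations. Both the `E i` (with `p = q`) and the `F i` (with `p = q⁻¹`) form such a
family, whatever their types. Only the entries `-1` and `0` of `A` impose Serre relations, which is
all of them for a simply laced Cartan matrix. -/
structure IsRootFamily (A : Matrix ι ι ℤ) (p : k) (X K Kb : ι → B) : Prop where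
  K_mul : ∀ i j, K j * X i = p ^ A i j • (X i * K j)
  mul_Kb : ∀ i j, X i * Kb j = p ^ A i j • (Kb j * X i)
  serre : ∀ i j, A i j = -1 → IsSerrePair (p + p⁻¹) (X i) (X j)
  comm : ∀ i j, A i j = 0 → Commute (X i) (X j)

namespace IsRootFamily

theorem Kb_mul (h : IsRootFamily A p X K Kb) (hp : p ≠ 0) (i j : ι) :
    Kb j * X i = p⁻¹ ^ A i j • (X i * Kb j) := by
  rw [h.mul_Kb, smul_smul, inv_zpow, inv_mul_cancel₀ (zpow_ne_zero _ hp), one_smul]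

theorem mul_K (h : IsRootFamily A p X K Kb) (hp : p ≠ 0) (i j : ι) :
    X i * K j = p⁻¹ ^ A i j • (K j * X i) := by
  rw [h.K_mul, smul_smul, inv_zpow, inv_mul_cancel₀ (zpow_ne_zero _ hp), one_smul]

theorem commute_J (h : IsRootFamily A p X K Kb) (hp : p ≠ 0) (i j : ι) :
    Commute (K j * Kb j) (X i) := by
  rw [commute_iff_eq, ← mul_assoc, h.mul_K hp, mul_assoc, h.Kb_mul hp, mul_smul_comm,
    smul_mul_assoc, mul_assoc]

theorem swap (h : IsRootFamily A p X K Kb) (hp : p ≠ 0) : IsRootFamily A p⁻¹ X Kb K where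
  K_mul := h.Kb_mul hp
  mul_Kb := h.mul_K hp
  serre i j hij := by simpa [add_comm] using h.serre i j hij
  comm := h.comm

theorem map (h : IsRootFamily A p X K Kb) (f : B →ₐ[k] C) :
    IsRootFamily A p (fun i => f (X i)) (fun i => f (K i)) (fun i => f (Kb i)) where
  K_mul i j := by simpa using congrArg f (h.K_mul i j)
  mul_Kb i j := by simpa using congrArg f (h.mul_Kb i j)
  serre i j hij := (h.serre i j hij).map f
  comm i j hij := (h.comm i j hij).map f

theorem op (h : IsRootFamily A p X K Kb) :
    IsRootFamily A p (fun i => MulOpposite.op (X i)) (fun i => MulOpposite.op (Kb i))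
      (fun i => MulOpposite.op (K i)) where
  K_mul i j := congrArg MulOpposite.op (h.mul_Kb i j)
  mul_Kb i j := congrArg MulOpposite.op (h.K_mul i j)
  serre i j hij := (h.serre i j hij).op
  comm i j hij := (h.comm i j hij).op

theorem mul_neg_Kb (h : IsRootFamily A p X K Kb) (hA : A.IsSymm) (hp : p ≠ 0)
    (hK : IsTorus K Kb) : IsRootFamily A p (fun i => X i * -Kb i) K Kb where
  K_mul i j := by
    rw [← mul_assoc, h.K_mul, smul_mul_assoc, mul_assoc, mul_assoc,
      (hK.K_Kb_comm j i).neg_right.eq]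
  mul_Kb i j := by
    rw [mul_assoc, ((hK.Kb_comm i j).neg_left).eq, ← mul_assoc, h.mul_Kb, smul_mul_assoc,
      mul_assoc]
  serre i j hij := by
    have neg_Kb_mul (i j) : -Kb j * X i = p⁻¹ ^ A i j • (X i * -Kb j) := by
      rw [neg_mul, h.Kb_mul hp, mul_neg, smul_neg]
    refine (h.serre i j hij).mul (hK.Kb_comm i j).neg_left.neg_right (neg_Kb_mul i i)
      (neg_Kb_mul j i) ?_
    rw [neg_Kb_mul, hA.apply]
  comm i j hij := by
    have commute_Kb {i j} (hij : A i j = 0) : Commute (X i) (Kb j) := by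
      rw [commute_iff_eq, h.mul_Kb, hij, zpow_zero, one_smul]
    refine .mul_left (.mul_right (h.comm i j hij) (commute_Kb hij).neg_right)
      (.mul_right (commute_Kb ?_).symm.neg_left (hK.Kb_comm i j).neg_left.neg_right)
    rwa [hA.apply]

theorem comul (h : IsRootFamily A p X K Kb) (hA : A.IsSymm) (hA₂ : ∀ i, A i i = 2) (hp : p ≠ 0)
    (hK : IsTorus K Kb) {u : ι → B} (huu : ∀ i j, Commute (u i) (u j))
    (huX : ∀ i j, Commute (u i) (X j)) (huK : ∀ i j, Commute (u i) (K j))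
    (huKb : ∀ i j, Commute (u i) (Kb j)) :
    IsRootFamily A p (fun i => u i ⊗ₜ[k] X i + X i ⊗ₜ[k] K i) (fun i => K i ⊗ₜ[k] K i)
      (fun i => Kb i ⊗ₜ[k] Kb i) := by
  have qcomm (i j) : X i ⊗ₜ[k] K i * u j ⊗ₜ[k] X j =
      p ^ A i j • (u j ⊗ₜ[k] X j * X i ⊗ₜ[k] K i) := by
    simp only [Algebra.TensorProduct.tmul_mul_tmul, h.K_mul, hA.apply, TensorProduct.tmul_smul,
      (huX j i).eq]
  have commute {i j} (hij : A i j = 0) : Commute (X i ⊗ₜ[k] K i) (u j ⊗ₜ[k] X j) := by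
    rw [commute_iff_eq, qcomm, hij, zpow_zero, one_smul]
  refine ⟨fun i j => ?_, fun i j => ?_, fun i j hij => ?_, fun i j hij => ?_⟩
  · simp only [mul_add, add_mul, Algebra.TensorProduct.tmul_mul_tmul, h.K_mul, (huK i j).eq,
      (hK.K_comm j i).eq, TensorProduct.tmul_smul, TensorProduct.smul_tmul', smul_add]
  · simp only [mul_add, add_mul, Algebra.TensorProduct.tmul_mul_tmul, h.mul_Kb, (huKb i j).eq,
      (hK.K_Kb_comm i j).eq, TensorProduct.tmul_smul, TensorProduct.smul_tmul', smul_add]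
  · refine ((h.serre i j hij).tmul_left (huu i j)).add hp
      ((h.serre i j hij).tmul_right (hK.K_comm i j)) ?_ ?_ ?_
    · simpa [hA₂] using qcomm i i
    · simpa [hij] using qcomm i j
    · simpa [hij, hA.apply] using qcomm j i
  · have hji : A j i = 0 := hA.apply j i ▸ hij
    exact .add_left
      (.add_right ((huu i j).tmul (h.comm i j hij)) (commute hji).symm)
      (.add_right (commute hij) ((h.comm i j hij).tmul (hK.K_comm i j)))

theorem comul_swap (h : IsRootFamily A p X K Kb) (hA : A.IsSymm) (hA₂ : ∀ i, A i i = 2)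
    (hp : p ≠ 0) (hK : IsTorus K Kb) {u : ι → B} (huu : ∀ i j, Commute (u i) (u j))
    (huX : ∀ i j, Commute (u i) (X j)) (huK : ∀ i j, Commute (u i) (K j))
    (huKb : ∀ i j, Commute (u i) (Kb j)) :
    IsRootFamily A p (fun i => X i ⊗ₜ[k] u i + Kb i ⊗ₜ[k] X i) (fun i => K i ⊗ₜ[k] K i)
      (fun i => Kb i ⊗ₜ[k] Kb i) := by
  have hpi := inv_ne_zero hp
  simpa using (((h.swap hp).comul hA hA₂ hpi hK.swap huu huX huKb huK).map
    (Algebra.TensorProduct.comm k B B).toAlgHom).swap hpi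

end IsRootFamily

end RootFamily

section TypeUnit

variable {k B : Type*} [CommSemiring k] [Semiring B] [Algebra k B] {J x : B}

/-- The element taking the place of `1` in the coproduct of a generator of type `b`: it is `1` for
type 1 (`true`) and `J` for type 2 (`false`). A type 2 relation for `X` amounts to the type 1
relations together with `typeUnit b J * X = X`. -/
def typeUnit (b : Bool) (J : B) : B := bif b then 1 else J

theorem commute_typeUnit (b : Bool) (h : Commute J x) : Commute (typeUnit b J) x := by
  cases b
  exacts [h, Commute.one_left x]

theorem typeUnit_mul (b : Bool) (h : J * x = x) : typeUnit b J * x = x := by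
  cases b
  exacts [h, one_mul x]

theorem typeUnit_mul_self (b : Bool) (h : IsIdempotentElem J) :
    typeUnit b J * typeUnit b J = typeUnit b J := by
  cases b
  exacts [h, one_mul 1]

theorem typeUnit_op (b : Bool) (J : B) :
    typeUnit b (MulOpposite.op J) = MulOpposite.op (typeUnit b J) := by
  cases b <;> rfl

theorem typeUnit_tmul_self (b : Bool) (J : B) :
    typeUnit b (J ⊗ₜ[k] J) = typeUnit b J ⊗ₜ[k] typeUnit b J := by
  cases b <;> rfl

end TypeUnit

theorem comul_mul_sub_mul_comul {k B : Type*} [CommRing k] [Ring B] [Algebra k B]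
    {e f κ κ' u v : B} (huf : Commute u f) (huκ' : Commute u κ') (hve : Commute v e)
    (hvκ : Commute v κ) (hcross : (e * κ') ⊗ₜ[k] (κ * f) = (κ' * e) ⊗ₜ[k] (f * κ)) :
    (u ⊗ₜ[k] e + e ⊗ₜ[k] κ) * (f ⊗ₜ[k] v + κ' ⊗ₜ[k] f) -
        (f ⊗ₜ[k] v + κ' ⊗ₜ[k] f) * (u ⊗ₜ[k] e + e ⊗ₜ[k] κ) =
      (u * κ') ⊗ₜ[k] (e * f - f * e) + (e * f - f * e) ⊗ₜ[k] (v * κ) := by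
  simp only [mul_add, add_mul, Algebra.TensorProduct.tmul_mul_tmul, hcross, huf.eq, huκ'.eq,
    hve.eq, hvκ.eq, TensorProduct.tmul_sub, TensorProduct.sub_tmul]
  abel

theorem commute_sub_mul {B : Type*} [NonUnitalRing B] {J x y : B} (hx : Commute J x)
    (hy : Commute J y) (hJy : J * y = y) : Commute (x - J * x) y := by
  have h₁ : J * x * y = x * y := by rw [hx.eq, mul_assoc, hJy]
  have h₂ : y * (J * x) = y * x := by rw [← mul_assoc, ← hy.eq, hJy]
  rw [commute_iff_eq, sub_mul, mul_sub, h₁, h₂, sub_self, sub_self]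

section Centralizer

variable {k ι B : Type*} [CommSemiring k] [Semiring B] [Algebra k B] {E F K Kb : ι → B}

/-- The common centralizer of the `E i`, `K i`, `K̄ i` and `J * F i`. It contains the values of
`id * T` and commutes with those of the weak antipode `T`. -/
def antipodeCentralizer (k : Type*) [CommSemiring k] [Algebra k B] (E F K Kb : ι → B) :
    Subalgebra k B :=
  Subalgebra.centralizer k
    {x | ∃ i, x = E i ∨ x = K i ∨ x = Kb i ∨ x = K i * Kb i * F i}

theorem mem_antipodeCentralizer {z : B} :
    z ∈ antipodeCentralizer k E F K Kb ↔ ∀ i, Commute (E i) z ∧ Commute (K i) z ∧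
      Commute (Kb i) z ∧ Commute (K i * Kb i * F i) z := by
  simp only [antipodeCentralizer, Subalgebra.mem_centralizer_iff, Set.mem_ofPred_eq, commute_iff_eq]
  grind

end Centralizer

section Realization

variable {k ι B : Type*} [Field k] [DecidableEq ι] [Ring B] [Algebra k B] {A : Matrix ι ι ℤ}
  {q : k} {d : ι ⊕ ι → Bool} {E F K Kb : ι → B}

/-- `E`, `F`, `K`, `Kb` satisfy the relations of the generators of `wsl_q^d(n)`, the type 2
relations being expressed through `typeUnit` and the Cartan matrix `A` being arbitrary. -/
structure IsRealization (A : Matrix ι ι ℤ) (q : k) (d : ι ⊕ ι → Bool) (E F K Kb : ι → B) :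
    Prop where
  torus : IsTorus K Kb
  rootE : IsRootFamily A q E K Kb
  rootF : IsRootFamily A q⁻¹ F K Kb
  typeUnit_mul_E : ∀ i, typeUnit (d (.inl i)) (K i * Kb i) * E i = E i
  typeUnit_mul_F : ∀ i, typeUnit (d (.inr i)) (K i * Kb i) * F i = F i
  bracket : ∀ i j, E i * F j - F j * E i = if i = j then (q - q⁻¹)⁻¹ • (K i - Kb i) else 0

namespace IsRealization

theorem counit : IsRealization A q d (0 : ι → k) 0 1 1 where
  torus := by constructor <;> simp
  rootE := by constructor <;> simp [IsSerrePair]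
  rootF := by constructor <;> simp [IsSerrePair]
  typeUnit_mul_E := by simp
  typeUnit_mul_F := by simp
  bracket := by simp

theorem F_mul_typeUnit (h : IsRealization A q d E F K Kb) (hq0 : q ≠ 0) (i : ι) :
    F i * typeUnit (d (.inr i)) (K i * Kb i) = F i := by
  rw [← (commute_typeUnit _ (h.rootF.commute_J (inv_ne_zero hq0) i i)).eq, h.typeUnit_mul_F]

theorem bracket_antipode (h : IsRealization A q d E F K Kb) (hA : A.IsSymm)
    (hA₂ : ∀ i, A i i = 2) (hq0 : q ≠ 0) (i j : ι) :
    K j * F j * (E i * Kb i) - E i * Kb i * (K j * F j) =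
      if i = j then (q - q⁻¹)⁻¹ • (Kb i - K i) else 0 := by
  have hqi := inv_ne_zero hq0
  have KF : K j * F j = q⁻¹ ^ (2 : ℤ) • (F j * K j) := by rw [h.rootF.K_mul, hA₂]
  have left : K j * F j * (E i * Kb i) =
      (q⁻¹ ^ (2 : ℤ) * q ^ A i j) • (F j * E i * (Kb i * K j)) := by
    rw [KF, smul_mul_assoc, mul_assoc, ← mul_assoc (K j), h.rootE.K_mul, smul_mul_assoc,
      mul_smul_comm, smul_smul, mul_assoc (E i), (h.torus.K_Kb_comm j i).eq, mul_assoc]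
  have right : E i * Kb i * (K j * F j) =
      (q⁻¹ ^ (2 : ℤ) * q ^ A i j) • (E i * F j * (Kb i * K j)) := by
    rw [KF, mul_smul_comm, mul_assoc, ← mul_assoc (Kb i), h.rootF.Kb_mul hqi, inv_inv, hA.apply,
      smul_mul_assoc, mul_smul_comm, smul_smul, mul_assoc (F j), mul_assoc]
  rw [left, right, ← smul_sub, ← sub_mul, ← neg_sub, h.bracket]
  split_ifs with hij
  · subst hij
    rw [hA₂, inv_zpow, inv_mul_cancel₀ (zpow_ne_zero _ hq0), one_smul, ← smul_neg, neg_sub,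
      smul_mul_assoc, ← (h.torus.K_Kb_comm i i).eq, sub_mul, h.torus.K_mul_J, h.torus.Kb_mul_J]
  · rw [neg_zero, zero_mul, smul_zero]

theorem antipode (h : IsRealization A q d E F K Kb) (hA : A.IsSymm) (hA₂ : ∀ i, A i i = 2)
    (hq0 : q ≠ 0) :
    IsRealization A q d (fun i => MulOpposite.op (-(E i * Kb i)))
      (fun i => MulOpposite.op (-(K i * F i))) (fun i => MulOpposite.op (Kb i))
      (fun i => MulOpposite.op (K i)) where
  torus := h.torus.op_swap
  rootE := by simpa only [mul_neg] using (h.rootE.mul_neg_Kb hA hq0 h.torus).op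
  rootF := by
    simpa only [mul_neg, MulOpposite.op_neg, MulOpposite.op_mul] using
      h.rootF.op.mul_neg_Kb hA (inv_ne_zero hq0) h.torus.op_swap
  typeUnit_mul_E i := by
    have hu : Commute (typeUnit (d (.inl i)) (K i * Kb i)) (Kb i) :=
      commute_typeUnit _ (h.torus.commute_J_Kb i i)
    have hE : Commute (typeUnit (d (.inl i)) (K i * Kb i)) (E i) :=
      commute_typeUnit _ (h.rootE.commute_J hq0 i i)
    rw [← MulOpposite.op_mul, typeUnit_op, ← MulOpposite.op_mul, neg_mul, ← (hE.mul_right hu).eq,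
      ← mul_assoc, h.typeUnit_mul_E]
  typeUnit_mul_F i := by
    rw [← MulOpposite.op_mul, typeUnit_op, ← MulOpposite.op_mul, neg_mul, mul_assoc,
      h.F_mul_typeUnit hq0]
  bracket i j := by
    rw [← MulOpposite.op_mul, ← MulOpposite.op_mul, ← MulOpposite.op_sub, neg_mul_neg, neg_mul_neg,
      h.bracket_antipode hA hA₂ hq0, apply_ite MulOpposite.op, MulOpposite.op_smul,
      MulOpposite.op_sub, MulOpposite.op_zero]

section Comul

variable (h : IsRealization A q d E F K Kb)
include h

theorem commute_typeUnit_typeUnit (b c : Bool) (i j : ι) :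
    Commute (typeUnit b (K i * Kb i)) (typeUnit c (K j * Kb j)) :=
  commute_typeUnit b <| .symm <| commute_typeUnit c <|
    (h.torus.commute_J_K j i).mul_right (h.torus.commute_J_Kb j i)

theorem bracket_comul (hA : A.IsSymm) (hq0 : q ≠ 0) (b c : Bool) (i j : ι) :
    (typeUnit b (K i * Kb i) ⊗ₜ[k] E i + E i ⊗ₜ[k] K i) *
        (F j ⊗ₜ[k] typeUnit c (K j * Kb j) + Kb j ⊗ₜ[k] F j) -
      (F j ⊗ₜ[k] typeUnit c (K j * Kb j) + Kb j ⊗ₜ[k] F j) *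
        (typeUnit b (K i * Kb i) ⊗ₜ[k] E i + E i ⊗ₜ[k] K i) =
      if i = j then (q - q⁻¹)⁻¹ • (K i ⊗ₜ[k] K i - Kb i ⊗ₜ[k] Kb i) else 0 := by
  have cross : (E i * Kb j) ⊗ₜ[k] (K i * F j) = (Kb j * E i) ⊗ₜ[k] (F j * K i) := by
    rw [h.rootE.mul_Kb, h.rootF.K_mul, TensorProduct.smul_tmul_smul, hA.apply, inv_zpow,
      mul_inv_cancel₀ (zpow_ne_zero _ hq0), one_smul]
  rw [comul_mul_sub_mul_comul (commute_typeUnit b (h.rootF.commute_J (inv_ne_zero hq0) j i))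
      (commute_typeUnit b (h.torus.commute_J_Kb i j))
      (commute_typeUnit c (h.rootE.commute_J hq0 i j))
      (commute_typeUnit c (h.torus.commute_J_K j i)) cross,
    typeUnit_mul b (h.torus.J_mul_Kb i j), typeUnit_mul c (h.torus.J_mul_K j i), h.bracket]
  split_ifs with hij
  · subst hij
    rw [TensorProduct.tmul_smul, ← TensorProduct.smul_tmul', ← smul_add, TensorProduct.tmul_sub,
      TensorProduct.sub_tmul, sub_add_sub_cancel']
  · rw [TensorProduct.tmul_zero, TensorProduct.zero_tmul, add_zero]

theorem comul (hA : A.IsSymm) (hA₂ : ∀ i, A i i = 2) (hq0 : q ≠ 0) :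
    IsRealization A q d
      (fun i => typeUnit (d (.inl i)) (K i * Kb i) ⊗ₜ[k] E i + E i ⊗ₜ[k] K i)
      (fun i => F i ⊗ₜ[k] typeUnit (d (.inr i)) (K i * Kb i) + Kb i ⊗ₜ[k] F i)
      (fun i => K i ⊗ₜ[k] K i) (fun i => Kb i ⊗ₜ[k] Kb i) where
  torus := h.torus.tmul_self
  rootE := h.rootE.comul hA hA₂ hq0 h.torus (fun i j => h.commute_typeUnit_typeUnit _ _ i j)
    (fun i j => commute_typeUnit _ (h.rootE.commute_J hq0 j i))
    (fun i j => commute_typeUnit _ (h.torus.commute_J_K i j))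
    (fun i j => commute_typeUnit _ (h.torus.commute_J_Kb i j))
  rootF := h.rootF.comul_swap hA hA₂ (inv_ne_zero hq0) h.torus
    (fun i j => h.commute_typeUnit_typeUnit _ _ i j)
    (fun i j => commute_typeUnit _ (h.rootF.commute_J (inv_ne_zero hq0) j i))
    (fun i j => commute_typeUnit _ (h.torus.commute_J_K i j))
    (fun i j => commute_typeUnit _ (h.torus.commute_J_Kb i j))
  typeUnit_mul_E i := by
    rw [Algebra.TensorProduct.tmul_mul_tmul, typeUnit_tmul_self, mul_add,
      Algebra.TensorProduct.tmul_mul_tmul, Algebra.TensorProduct.tmul_mul_tmul,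
      typeUnit_mul_self _ (h.torus.isIdempotentElem_J i), h.typeUnit_mul_E,
      typeUnit_mul _ (h.torus.J_mul_K i i)]
  typeUnit_mul_F i := by
    rw [Algebra.TensorProduct.tmul_mul_tmul, typeUnit_tmul_self, mul_add,
      Algebra.TensorProduct.tmul_mul_tmul, Algebra.TensorProduct.tmul_mul_tmul,
      typeUnit_mul_self _ (h.torus.isIdempotentElem_J i), h.typeUnit_mul_F,
      typeUnit_mul _ (h.torus.J_mul_Kb i i)]
  bracket := fun i j => h.bracket_comul hA hq0 (d (.inl i)) (d (.inr j)) i j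

end Comul

theorem J_mem_antipodeCentralizer (h : IsRealization A q d E F K Kb) (hq0 : q ≠ 0) (i : ι) :
    K i * Kb i ∈ antipodeCentralizer k E F K Kb :=
  mem_antipodeCentralizer.mpr fun j =>
    ⟨(h.rootE.commute_J hq0 j i).symm, (h.torus.commute_J_K i j).symm,
      (h.torus.commute_J_Kb i j).symm, .symm <|
        ((h.torus.commute_J_K i j).mul_right (h.torus.commute_J_Kb i j)).mul_right
          (h.rootF.commute_J (inv_ne_zero hq0) j i)⟩

theorem commute_E_sub_J_mul_F (h : IsRealization A q d E F K Kb) (hq0 : q ≠ 0) (i j : ι) :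
    Commute (E j) (F i - K i * Kb i * F i) := by
  have J_mul_bracket : K i * Kb i * (E j * F i - F i * E j) = E j * F i - F i * E j := by
    rw [h.bracket]
    split_ifs
    · rw [mul_smul_comm, mul_sub, h.torus.J_mul_K, h.torus.J_mul_Kb]
    · rw [mul_zero]
  rw [mul_sub, sub_eq_sub_iff_sub_eq_sub, ← mul_assoc _ (F i), ← mul_assoc _ (E j),
    (h.rootE.commute_J hq0 j i).eq, mul_assoc (E j)] at J_mul_bracket
  rw [commute_iff_eq, mul_sub, sub_mul, ← neg_sub, J_mul_bracket, neg_sub]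

theorem sub_J_mul_F_mem_antipodeCentralizer (h : IsRealization A q d E F K Kb) (hq0 : q ≠ 0)
    (i : ι) : F i - K i * Kb i * F i ∈ antipodeCentralizer k E F K Kb := by
  have hF (j) := h.rootF.commute_J (inv_ne_zero hq0) j i
  refine mem_antipodeCentralizer.mpr fun j => ⟨h.commute_E_sub_J_mul_F hq0 i j,
    (commute_sub_mul (hF i) (h.torus.commute_J_K i j) (h.torus.J_mul_K i j)).symm,
    (commute_sub_mul (hF i) (h.torus.commute_J_Kb i j) (h.torus.J_mul_Kb i j)).symm,
    (commute_sub_mul (hF i) ?_ ?_).symm⟩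
  · rw [h.torus.J_eq j i]
    exact (Commute.refl _).mul_right (hF j)
  · rw [h.torus.J_eq j i, ← mul_assoc, h.torus.isIdempotentElem_J]

end IsRealization

end Realization

section Cartan

variable {n : ℕ}

theorem cartan_self (i : Fin (n - 1)) : cartan i i = 2 :=
  congrFun (CartanMatrix.A_diag (n - 1)) i

theorem cartan_eq_neg_one_iff {i j : Fin (n - 1)} :
    cartan i j = -1 ↔ (i : ℕ) + 1 = j ∨ (j : ℕ) + 1 = i := by
  simp only [cartan, CartanMatrix.A, Matrix.of_apply]
  grind

theorem cartan_eq_zero_iff {i j : Fin (n - 1)} :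
    cartan i j = 0 ↔ (i : ℕ) + 2 ≤ j ∨ (j : ℕ) + 2 ≤ i := by
  simp only [cartan, CartanMatrix.A, Matrix.of_apply]
  grind

end Cartan

section TypeTwo

variable {k ι B : Type*} [Field k] [Ring B] [Algebra k B] {A : Matrix ι ι ℤ} {p c : k}
  {X K Kb : ι → B} {x : B} {j : ι}

namespace IsTorus

theorem J_mul_of_mul_mul_eq_smul (h : IsTorus K Kb) (hc : c ≠ 0) (hx : K j * x * Kb j = c • x) :
    K j * Kb j * x = x := by
  apply (IsUnit.mk0 c hc).smul_left_cancel.mp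
  rw [← mul_smul_comm, ← hx, ← mul_assoc, ← mul_assoc, h.J_mul_K]

theorem mul_J_of_mul_mul_eq_smul (h : IsTorus K Kb) (hc : c ≠ 0) (hx : K j * x * Kb j = c • x) :
    x * (K j * Kb j) = x := by
  apply (IsUnit.mk0 c hc).smul_left_cancel.mp
  rw [← smul_mul_assoc, ← hx, mul_assoc, h.Kb_mul_J]

theorem K_mul_of_mul_mul_eq_smul (h : IsTorus K Kb) (hc : c ≠ 0) (hx : K j * x * Kb j = c • x) :
    K j * x = c • (x * K j) := by
  rw [← smul_mul_assoc, ← hx, mul_assoc _ (Kb j), ← (h.K_Kb_comm j j).eq, mul_assoc,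
    h.mul_J_of_mul_mul_eq_smul hc hx]

theorem mul_Kb_of_mul_mul_eq_smul (h : IsTorus K Kb) (hc : c ≠ 0) (hx : K j * x * Kb j = c • x) :
    x * Kb j = c • (Kb j * x) := by
  rw [← mul_smul_comm, ← hx, ← mul_assoc, ← mul_assoc, ← (h.K_Kb_comm j j).eq,
    h.J_mul_of_mul_mul_eq_smul hc hx]

end IsTorus

theorem IsRootFamily.K_mul_mul_Kb (h : IsRootFamily A p X K Kb) (hp : p ≠ 0) {i : ι}
    (hJ : K j * Kb j * X i = X i) : K j * X i * Kb j = p ^ A i j • X i := by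
  rw [h.K_mul, smul_mul_assoc, mul_assoc, ← (h.commute_J hp i j).eq, hJ]

end TypeTwo

section Presentation

variable {k B : Type*} [Field k] [Ring B] [Algebra k B] {q : k} {n : ℕ} {d : TypeAssignment n}
  {eB fB kB kbB : Fin (n - 1) → B}

/-- The map on generators sending `E_i`, `F_i`, `K_i`, `K̄_i` to the given elements; used to
specify homomorphisms out of `wsl_q^d(n)`. -/
def Gen.elim (E F K Kb : Fin (n - 1) → B) : Gen n → B
  | .E i => E i
  | .F i => F i
  | .K i => K i
  | .Kbar i => Kb i

theorem IsRealization.lift_eq_of_rel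
    (h : IsRealization (CartanMatrix.A (n - 1)) q d eB fB kB kbB) (hq0 : q ≠ 0)
    ⦃x y : FreeAlgebra k (Gen n)⦄ (hxy : Rel k n q d x y) :
    FreeAlgebra.lift k (Gen.elim eB fB kB kbB) x =
      FreeAlgebra.lift k (Gen.elim eB fB kB kbB) y := by
  have J_mul_E (i j) (hi : d (.inl i) = false) : kB j * kbB j * eB i = eB i := by
    simpa [typeUnit, hi, h.torus.J_eq i j] using h.typeUnit_mul_E i
  have J_mul_F (i j) (hi : d (.inr i) = false) : kB j * kbB j * fB i = fB i := by
    simpa [typeUnit, hi, h.torus.J_eq i j] using h.typeUnit_mul_F i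
  induction hxy with
  | K_comm i j => simpa [Gen.elim] using (h.torus.K_comm i j).eq
  | Kbar_comm i j => simpa [Gen.elim] using (h.torus.Kb_comm i j).eq
  | K_Kbar_comm i j => simpa [Gen.elim] using (h.torus.K_Kb_comm i j).eq
  | J_eq i j => simpa [Gen.elim] using h.torus.J_eq i j
  | J_K i j => simpa [Gen.elim] using h.torus.J_mul_K i j
  | K_J i j => simpa [Gen.elim] using h.torus.K_mul_J i j
  | J_Kbar i j => simpa [Gen.elim] using h.torus.J_mul_Kb i j
  | Kbar_J i j => simpa [Gen.elim] using h.torus.Kb_mul_J i j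
  | EF_same i => simpa [Gen.elim] using h.bracket i i
  | EF_diff i j hij => simpa [Gen.elim, hij] using h.bracket i j
  | serreE i j hij =>
    simpa [Gen.elim, IsSerrePair] using h.rootE.serre i j (cartan_eq_neg_one_iff.mpr hij)
  | serreF i j hij =>
    simpa [Gen.elim, IsSerrePair, add_comm] using
      h.rootF.serre i j (cartan_eq_neg_one_iff.mpr hij)
  | E_comm i j hij => simpa [Gen.elim] using (h.rootE.comm i j (cartan_eq_zero_iff.mpr hij)).eq
  | F_comm i j hij => simpa [Gen.elim] using (h.rootF.comm i j (cartan_eq_zero_iff.mpr hij)).eq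
  | E_type1_K i j => simpa [Gen.elim] using h.rootE.K_mul i j
  | E_type1_Kbar i j => simpa [Gen.elim] using h.rootE.mul_Kb i j
  | E_type2 i j hi => simpa [Gen.elim] using h.rootE.K_mul_mul_Kb hq0 (J_mul_E i j hi)
  | F_type1_K i j => simpa [Gen.elim] using h.rootF.K_mul i j
  | F_type1_Kbar i j => simpa [Gen.elim] using h.rootF.mul_Kb i j
  | F_type2 i j hi =>
    simpa [Gen.elim] using h.rootF.K_mul_mul_Kb (inv_ne_zero hq0) (J_mul_F i j hi)

/-- The homomorphism from `wsl_q^d(n)` with given values on the generators. -/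
noncomputable def lift (h : IsRealization (CartanMatrix.A (n - 1)) q d eB fB kB kbB)
    (hq0 : q ≠ 0) : Alg k q n d →ₐ[k] B :=
  RingQuot.liftAlgHom k ⟨FreeAlgebra.lift k (Gen.elim eB fB kB kbB), h.lift_eq_of_rel hq0⟩

theorem lift_gen (h : IsRealization (CartanMatrix.A (n - 1)) q d eB fB kB kbB) (hq0 : q ≠ 0)
    (x : Gen n) : lift h hq0 (gen x) = Gen.elim eB fB kB kbB x := by
  rw [lift, gen, RingQuot.liftAlgHom_mkAlgHom_apply, FreeAlgebra.lift_ι_apply]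

theorem algHom_ext {f g : Alg k q n d →ₐ[k] B} (hE : ∀ i, f (E i) = g (E i))
    (hF : ∀ i, f (F i) = g (F i)) (hK : ∀ i, f (K i) = g (K i))
    (hKbar : ∀ i, f (Kbar i) = g (Kbar i)) : f = g := by
  refine RingQuot.ringQuot_ext' _ _ _ (FreeAlgebra.hom_ext (funext fun x => ?_))
  cases x
  exacts [hE _, hF _, hK _, hKbar _]

theorem adjoin_range_gen : Algebra.adjoin k (Set.range (gen : Gen n → Alg k q n d)) = ⊤ := by
  have hrange : Set.range (gen : Gen n → Alg k q n d) =
      RingQuot.mkAlgHom k (Rel k n q d) '' Set.range (FreeAlgebra.ι k) := by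
    rw [← Set.range_comp]
    rfl
  rw [hrange, ← AlgHom.map_adjoin, FreeAlgebra.adjoin_range_ι, Algebra.map_top,
    AlgHom.range_eq_top]
  exact RingQuot.mkAlgHom_surjective k (Rel k n q d)

theorem isTorus_gen : IsTorus (K : _ → Alg k q n d) Kbar := by
  have rel {x y} (h : Rel k n q d x y) := RingQuot.mkAlgHom_rel k h
  exact
    { K_comm := fun i j => by simpa [commute_iff_eq, gen] using rel (.K_comm i j)
      Kb_comm := fun i j => by simpa [commute_iff_eq, gen] using rel (.Kbar_comm i j)
      K_Kb_comm := fun i j => by simpa [commute_iff_eq, gen] using rel (.K_Kbar_comm i j)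
      J_eq := fun i j => by simpa [gen] using rel (.J_eq i j)
      J_mul_K := fun i j => by simpa [gen] using rel (.J_K i j)
      J_mul_Kb := fun i j => by simpa [gen] using rel (.J_Kbar i j) }

theorem K_mul_E_mul_Kbar {i : Fin (n - 1)} (hi : d (.inl i) = false) (j : Fin (n - 1)) :
    (K j * E i * Kbar j : Alg k q n d) = q ^ cartan i j • E i := by
  simpa [gen] using RingQuot.mkAlgHom_rel k (Rel.E_type2 (k := k) (q := q) i j hi)

theorem K_mul_F_mul_Kbar {i : Fin (n - 1)} (hi : d (.inr i) = false) (j : Fin (n - 1)) :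
    (K j * F i * Kbar j : Alg k q n d) = q⁻¹ ^ cartan i j • F i := by
  simpa [gen] using RingQuot.mkAlgHom_rel k (Rel.F_type2 (k := k) (q := q) i j hi)

theorem isRootFamily_E (hq0 : q ≠ 0) :
    IsRootFamily (CartanMatrix.A (n - 1)) q (E : _ → Alg k q n d) K Kbar := by
  have rel {x y} (h : Rel k n q d x y) := RingQuot.mkAlgHom_rel k h
  have weight_ne_zero (i j : Fin (n - 1)) : q ^ cartan i j ≠ 0 := zpow_ne_zero _ hq0
  refine ⟨fun i j => ?_, fun i j => ?_, fun i j hij => ?_, fun i j hij => ?_⟩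
  · cases hi : d (.inl i)
    · exact isTorus_gen.K_mul_of_mul_mul_eq_smul (weight_ne_zero i j) (K_mul_E_mul_Kbar hi j)
    · simpa [gen] using rel (.E_type1_K i j hi)
  · cases hi : d (.inl i)
    · exact isTorus_gen.mul_Kb_of_mul_mul_eq_smul (weight_ne_zero i j) (K_mul_E_mul_Kbar hi j)
    · simpa [gen] using rel (.E_type1_Kbar i j hi)
  · simpa [gen, IsSerrePair] using rel (.serreE i j (cartan_eq_neg_one_iff.mp hij))
  · simpa [gen, commute_iff_eq] using rel (.E_comm i j (cartan_eq_zero_iff.mp hij))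

theorem isRootFamily_F (hq0 : q ≠ 0) :
    IsRootFamily (CartanMatrix.A (n - 1)) q⁻¹ (F : _ → Alg k q n d) K Kbar := by
  have rel {x y} (h : Rel k n q d x y) := RingQuot.mkAlgHom_rel k h
  have weight_ne_zero (i j : Fin (n - 1)) : q⁻¹ ^ cartan i j ≠ 0 :=
    zpow_ne_zero _ (inv_ne_zero hq0)
  refine ⟨fun i j => ?_, fun i j => ?_, fun i j hij => ?_, fun i j hij => ?_⟩
  · cases hi : d (.inr i)
    · exact isTorus_gen.K_mul_of_mul_mul_eq_smul (weight_ne_zero i j) (K_mul_F_mul_Kbar hi j)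
    · simpa [gen] using rel (.F_type1_K i j hi)
  · cases hi : d (.inr i)
    · exact isTorus_gen.mul_Kb_of_mul_mul_eq_smul (weight_ne_zero i j) (K_mul_F_mul_Kbar hi j)
    · simpa [gen] using rel (.F_type1_Kbar i j hi)
  · simpa [gen, IsSerrePair, add_comm] using rel (.serreF i j (cartan_eq_neg_one_iff.mp hij))
  · simpa [gen, commute_iff_eq] using rel (.F_comm i j (cartan_eq_zero_iff.mp hij))

theorem isRealization_gen (hq0 : q ≠ 0) :
    IsRealization (CartanMatrix.A (n - 1)) q d (E : _ → Alg k q n d) F K Kbar where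
  torus := isTorus_gen
  rootE := isRootFamily_E hq0
  rootF := isRootFamily_F hq0
  typeUnit_mul_E i := by
    cases hi : d (.inl i)
    · exact isTorus_gen.J_mul_of_mul_mul_eq_smul (zpow_ne_zero _ hq0) (K_mul_E_mul_Kbar hi i)
    · exact one_mul _
  typeUnit_mul_F i := by
    cases hi : d (.inr i)
    · exact isTorus_gen.J_mul_of_mul_mul_eq_smul (zpow_ne_zero _ (inv_ne_zero hq0))
        (K_mul_F_mul_Kbar hi i)
    · exact one_mul _
  bracket i j := by
    split_ifs with hij
    · subst hij
      simpa [gen] using RingQuot.mkAlgHom_rel k (Rel.EF_same (d := d) (q := q) i)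
    · simpa [gen] using RingQuot.mkAlgHom_rel k (Rel.EF_diff (d := d) (q := q) i j hij)

end Presentation

section Bialgebra

variable {k : Type*} [Field k] {q : k} {n : ℕ} {d : TypeAssignment n}
  {Δ : Alg k q n d →ₐ[k] Alg k q n d ⊗[k] Alg k q n d} {ε : Alg k q n d →ₐ[k] k}

theorem exists_isCoproduct (hq0 : q ≠ 0) :
    ∃ Δ : Alg k q n d →ₐ[k] Alg k q n d ⊗[k] Alg k q n d, IsCoproduct Δ := by
  have h := (isRealization_gen (d := d) hq0).comul (CartanMatrix.A_isSymm _) cartan_self hq0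
  refine ⟨lift h hq0, fun _ => lift_gen h hq0 _, fun _ => lift_gen h hq0 _, ?_, ?_, ?_, ?_⟩ <;>
  intro i hi <;> simp [lift_gen, Gen.elim, typeUnit, hi]

theorem exists_isCounit (hq0 : q ≠ 0) : ∃ ε : Alg k q n d →ₐ[k] k, IsCounit ε := by
  have h : IsRealization (CartanMatrix.A (n - 1)) q d _ _ _ _ := .counit
  exact ⟨lift h hq0, fun _ => lift_gen h hq0 _, fun _ => lift_gen h hq0 _,
    fun _ => lift_gen h hq0 _, fun _ => lift_gen h hq0 _⟩

theorem exists_isAntipodeOnGenerators (hq0 : q ≠ 0) :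
    ∃ T : Alg k q n d →ₗ[k] Alg k q n d,
      T 1 = 1 ∧ (∀ x y, T (x * y) = T y * T x) ∧ IsAntipodeOnGenerators T := by
  have h := (isRealization_gen (d := d) hq0).antipode (CartanMatrix.A_isSymm _) cartan_self hq0
  refine ⟨(MulOpposite.opLinearEquiv k).symm.toLinearMap ∘ₗ (lift h hq0).toLinearMap, ?_, ?_,
    ?_, ?_, ?_, ?_⟩ <;>
  simp [lift_gen, Gen.elim]

namespace IsCoproduct

theorem comul_E (hΔ : IsCoproduct Δ) (i : Fin (n - 1)) :
    Δ (E i) = typeUnit (d (.inl i)) (J i) ⊗ₜ[k] E i + E i ⊗ₜ[k] K i := by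
  cases hi : d (.inl i)
  exacts [hΔ.comul_E_type2 i hi, hΔ.comul_E_type1 i hi]

theorem comul_F (hΔ : IsCoproduct Δ) (i : Fin (n - 1)) :
    Δ (F i) = F i ⊗ₜ[k] typeUnit (d (.inr i)) (J i) + Kbar i ⊗ₜ[k] F i := by
  cases hi : d (.inr i)
  exacts [hΔ.comul_F_type2 i hi, hΔ.comul_F_type1 i hi]

theorem comul_typeUnit (hΔ : IsCoproduct Δ) (b : Bool) (i : Fin (n - 1)) :
    Δ (typeUnit b (J i)) = typeUnit b (J i) ⊗ₜ[k] typeUnit b (J i) := by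
  cases b
  · simp [typeUnit, hΔ.comul_K, hΔ.comul_Kbar]
  · exact map_one Δ

end IsCoproduct

theorem IsCounit.counit_typeUnit (hε : IsCounit ε) (b : Bool) (i : Fin (n - 1)) :
    ε (typeUnit b (J i)) = 1 := by
  cases b <;> simp [typeUnit, hε.counit_K, hε.counit_Kbar]

theorem IsCoproduct.isBialgebra (hΔ : IsCoproduct Δ) (hε : IsCounit ε) : IsBialgebra Δ ε where
  coassoc := by
    apply algHom_ext <;> intro i <;>
    simp [hΔ.comul_E, hΔ.comul_F, hΔ.comul_K, hΔ.comul_Kbar, hΔ.comul_typeUnit,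
      TensorProduct.add_tmul, TensorProduct.tmul_add, add_assoc]
  counit_left := by
    apply algHom_ext <;> intro i <;>
    simp [hΔ.comul_E, hΔ.comul_F, hΔ.comul_K, hΔ.comul_Kbar, hε.counit_typeUnit, hε.counit_E,
      hε.counit_F, hε.counit_K, hε.counit_Kbar]
  counit_right := by
    apply algHom_ext <;> intro i <;>
    simp [hΔ.comul_E, hΔ.comul_F, hΔ.comul_K, hΔ.comul_Kbar, hε.counit_typeUnit, hε.counit_E,
      hε.counit_F, hε.counit_K, hε.counit_Kbar]

end Bialgebra

section Convolution

variable {k : Type*} [Field k] {q : k} {n : ℕ} {d : TypeAssignment n}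
  {Δ : Alg k q n d →ₐ[k] Alg k q n d ⊗[k] Alg k q n d} {T : Alg k q n d →ₗ[k] Alg k q n d}

namespace IsCoproduct

variable (hΔ : IsCoproduct Δ) (a b : Alg k q n d →ₗ[k] Alg k q n d) (i : Fin (n - 1))
include hΔ

theorem convolution_K : convolution Δ a b (K i) = a (K i) * b (K i) := by
  simp [convolution_apply, hΔ.comul_K]

theorem convolution_Kbar : convolution Δ a b (Kbar i) = a (Kbar i) * b (Kbar i) := by
  simp [convolution_apply, hΔ.comul_Kbar]

theorem convolution_typeUnit (c : Bool) :
    convolution Δ a b (typeUnit c (J i)) = a (typeUnit c (J i)) * b (typeUnit c (J i)) := by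
  simp [convolution_apply, hΔ.comul_typeUnit]

theorem convolution_E : convolution Δ a b (E i) =
    a (typeUnit (d (.inl i)) (J i)) * b (E i) + a (E i) * b (K i) := by
  simp [convolution_apply, hΔ.comul_E]

theorem convolution_F : convolution Δ a b (F i) =
    a (F i) * b (typeUnit (d (.inr i)) (J i)) + a (Kbar i) * b (F i) := by
  simp [convolution_apply, hΔ.comul_F]

end IsCoproduct

theorem IsAntipodeOnGenerators.apply_typeUnit (hT : IsAntipodeOnGenerators T) (T_one : T 1 = 1)
    (T_mul : ∀ x y, T (x * y) = T y * T x) (b : Bool) (i : Fin (n - 1)) :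
    T (typeUnit b (J i)) = typeUnit b (J i) := by
  cases b
  · simp only [typeUnit, cond_false, T_mul, hT.apply_K, hT.apply_Kbar]
  · exact T_one

theorem IsAntipodeOnGenerators.commute_apply_gen (hT : IsAntipodeOnGenerators T)
    {z : Alg k q n d} (hz : z ∈ antipodeCentralizer k E F K Kbar) (x : Gen n) :
    Commute z (T (gen x)) := by
  rw [mem_antipodeCentralizer] at hz
  cases x with
  | E i => exact hT.apply_E i ▸ ((hz i).1.mul_left (hz i).2.2.1).neg_left.symm
  | F i =>
    have hKF : (K i * F i : Alg k q n d) = K i * (K i * Kbar i * F i) := by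
      rw [← mul_assoc, isTorus_gen.K_mul_J]
    exact hT.apply_F i ▸ hKF ▸ ((hz i).2.1.mul_left (hz i).2.2.2).neg_left.symm
  | K i => exact hT.apply_K i ▸ (hz i).2.2.1.symm
  | Kbar i => exact hT.apply_Kbar i ▸ (hz i).2.1.symm

section IdT

variable (hΔ : IsCoproduct Δ) (hT : IsAntipodeOnGenerators T) (i : Fin (n - 1))
include hΔ hT

theorem convolution_id_antipode_K : convolution Δ LinearMap.id T (K i) = J i := by
  rw [hΔ.convolution_K, hT.apply_K, LinearMap.id_apply]

theorem convolution_id_antipode_Kbar : convolution Δ LinearMap.id T (Kbar i) = J i := by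
  rw [hΔ.convolution_Kbar, hT.apply_Kbar]
  exact (isTorus_gen.K_Kb_comm i i).eq.symm

theorem convolution_id_antipode_E (hq0 : q ≠ 0) : convolution Δ LinearMap.id T (E i) = 0 := by
  rw [hΔ.convolution_E, hT.apply_E, hT.apply_K, LinearMap.id_apply, LinearMap.id_apply,
    mul_neg (typeUnit (d (.inl i)) (J i)) (E i * Kbar i), ← mul_assoc,
    (isRealization_gen hq0).typeUnit_mul_E, neg_add_cancel]

variable (T_one : T 1 = 1) (T_mul : ∀ x y, T (x * y) = T y * T x)
include T_one T_mul

theorem convolution_id_antipode_typeUnit (b : Bool) :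
    convolution Δ LinearMap.id T (typeUnit b (J i)) = typeUnit b (J i) := by
  rw [hΔ.convolution_typeUnit, hT.apply_typeUnit T_one T_mul, LinearMap.id_apply,
    typeUnit_mul_self b (isTorus_gen.isIdempotentElem_J i)]

variable (hq0 : q ≠ 0)
include hq0

theorem convolution_id_antipode_F : convolution Δ LinearMap.id T (F i) = F i - J i * F i := by
  have h := isRealization_gen (d := d) hq0
  rw [hΔ.convolution_F, hT.apply_typeUnit T_one T_mul, hT.apply_F, LinearMap.id_apply,
    LinearMap.id_apply, h.F_mul_typeUnit hq0, mul_neg (Kbar i) (K i * F i), ← mul_assoc,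
    ← (isTorus_gen.K_Kb_comm i i).eq, sub_eq_add_neg]

theorem convolution_id_antipode_mem (x : Gen n) :
    convolution Δ LinearMap.id T (gen x) ∈ antipodeCentralizer k E F K Kbar := by
  have h := isRealization_gen (d := d) hq0
  cases x with
  | E i => exact convolution_id_antipode_E hΔ hT i hq0 ▸ zero_mem _
  | F i =>
    exact convolution_id_antipode_F hΔ hT i T_one T_mul hq0 ▸
      h.sub_J_mul_F_mem_antipodeCentralizer hq0 i
  | K i => exact convolution_id_antipode_K hΔ hT i ▸ h.J_mem_antipodeCentralizer hq0 i
  | Kbar i => exact convolution_id_antipode_Kbar hΔ hT i ▸ h.J_mem_antipodeCentralizer hq0 i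

theorem convolution_antipode_convolution_id_antipode (x : Gen n) :
    convolution Δ T (convolution Δ LinearMap.id T) (gen x) = T (gen x) := by
  have h := isRealization_gen (d := d) hq0
  cases x with
  | E i =>
    rw [hΔ.convolution_E, convolution_id_antipode_E hΔ hT i hq0,
      convolution_id_antipode_K hΔ hT i, hT.apply_E, mul_zero, zero_add,
      neg_mul (E i * Kbar i) (J i), mul_assoc, h.torus.Kb_mul_J]
  | F i =>
    rw [hΔ.convolution_F, convolution_id_antipode_typeUnit hΔ hT i T_one T_mul,
      convolution_id_antipode_F hΔ hT i T_one T_mul hq0, hT.apply_F, hT.apply_Kbar,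
      neg_mul (K i * F i) (typeUnit (d (.inr i)) (J i)), mul_assoc, h.F_mul_typeUnit hq0,
      mul_sub, ← mul_assoc, h.torus.K_mul_J, sub_self, add_zero]
  | K i =>
    rw [hΔ.convolution_K, convolution_id_antipode_K hΔ hT i, hT.apply_K, h.torus.Kb_mul_J]
  | Kbar i =>
    rw [hΔ.convolution_Kbar, convolution_id_antipode_Kbar hΔ hT i, hT.apply_Kbar,
      h.torus.K_mul_J]

theorem convolution_convolution_id_antipode_mulLeft {z : Alg k q n d}
    (hz : z ∈ antipodeCentralizer k E F K Kbar) (x : Gen n) :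
    convolution Δ (convolution Δ LinearMap.id T) (LinearMap.mulLeft k z) (gen x) = gen x * z := by
  have h := isRealization_gen (d := d) hq0
  have hz' := mem_antipodeCentralizer.mp hz
  have J_comm_z (i : Fin (n - 1)) : Commute (J i) z := (hz' i).2.1.mul_left (hz' i).2.2.1
  cases x with
  | E i =>
    rw [hΔ.convolution_E, convolution_id_antipode_typeUnit hΔ hT i T_one T_mul,
      convolution_id_antipode_E hΔ hT i hq0, zero_mul, add_zero, LinearMap.mulLeft_apply,
      ← (hz' i).1.eq, ← mul_assoc, h.typeUnit_mul_E]
  | F i =>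
    have u_comm_z : Commute (typeUnit (d (.inr i)) (J i)) z := commute_typeUnit _ (J_comm_z i)
    rw [hΔ.convolution_F, convolution_id_antipode_F hΔ hT i T_one T_mul hq0,
      convolution_id_antipode_Kbar hΔ hT i, LinearMap.mulLeft_apply, LinearMap.mulLeft_apply,
      ← u_comm_z.eq, ← mul_assoc, sub_mul (F i), mul_assoc (J i), h.F_mul_typeUnit hq0, sub_mul,
      ← mul_assoc (J i) z, (J_comm_z i).eq, mul_assoc z, ← (hz' i).2.2.2.eq, sub_add_cancel]
  | K i =>
    rw [hΔ.convolution_K, convolution_id_antipode_K hΔ hT i, LinearMap.mulLeft_apply,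
      ← (hz' i).2.1.eq, ← mul_assoc, h.torus.J_mul_K]
  | Kbar i =>
    rw [hΔ.convolution_Kbar, convolution_id_antipode_Kbar hΔ hT i, LinearMap.mulLeft_apply,
      ← (hz' i).2.2.1.eq, ← mul_assoc, h.torus.J_mul_Kb]

end IdT

theorem IsAntipodeOnGenerators.isWeakAntipode {ε : Alg k q n d →ₐ[k] k}
    (hT : IsAntipodeOnGenerators T) (hΔ : IsCoproduct Δ) (hε : IsCounit ε) (T_one : T 1 = 1)
    (T_mul : ∀ x y, T (x * y) = T y * T x) (hq0 : q ≠ 0) : IsWeakAntipode Δ T :=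
  isWeakAntipode_of_adjoin_eq_top (hΔ.isBialgebra hε) adjoin_range_gen T_one T_mul
    (fun _ hz => Set.forall_mem_range.mpr (hT.commute_apply_gen hz))
    (Set.forall_mem_range.mpr (convolution_id_antipode_mem hΔ hT T_one T_mul hq0))
    (Set.forall_mem_range.mpr
      (convolution_antipode_convolution_id_antipode hΔ hT T_one T_mul hq0))
    (Set.forall_mem_range.mpr fun x _ hz =>
      convolution_convolution_id_antipode_mulLeft hΔ hT T_one T_mul hq0 hz x)

end Convolution

theorem typesOf_bijective (n : ℕ) : Function.Bijective (typesOf n) := by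
  rw [Fintype.bijective_iff_injective_and_card]
  refine ⟨fun a b hab => Fin.ext (Nat.eq_of_testBit_eq fun t => ?_), by simp [two_mul]⟩
  obtain low | mid | high : t < n - 1 ∨ (n - 1 ≤ t ∧ t < 2 * (n - 1)) ∨ 2 * (n - 1) ≤ t := by lia
  · have hF := congrFun hab (.inr ⟨n - 1 - 1 - t, by lia⟩)
    rwa [typesOf, typesOf, show n - 1 - 1 - (n - 1 - 1 - t) = t by lia] at hF
  · have hE := congrFun hab (.inl ⟨2 * (n - 1) - 1 - t, by lia⟩)
    rwa [typesOf, typesOf, show 2 * (n - 1) - 1 - (2 * (n - 1) - 1 - t) = t by lia] at hE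
  · have testBit_eq_false (a : Fin (2 ^ (2 * (n - 1)))) : (a : ℕ).testBit t = false :=
      Nat.testBit_eq_false_of_lt (a.2.trans_le (Nat.pow_le_pow_right two_pos high))
    rw [testBit_eq_false, testBit_eq_false]

end WSl

theorem mainTheorem1 {k : Type*} [Field k] (q : k) (hq0 : q ≠ 0) (hq : q ^ 2 ≠ 1)
    (n : ℕ) (hn : 2 ≤ n) :
    Function.Bijective (WSl.typesOf n) ∧
    ∀ d : Fin (2 ^ (2 * (n - 1))),
      ∃ (Δ : WSl.Alg k q n (WSl.typesOf n d) →ₐ[k]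
            WSl.Alg k q n (WSl.typesOf n d) ⊗[k] WSl.Alg k q n (WSl.typesOf n d))
        (ε : WSl.Alg k q n (WSl.typesOf n d) →ₐ[k] k)
        (T : WSl.Alg k q n (WSl.typesOf n d) →ₗ[k] WSl.Alg k q n (WSl.typesOf n d)),
        WSl.IsCoproduct Δ ∧ WSl.IsCounit ε ∧ IsBialgebra Δ ε ∧
        WSl.IsAntipodeOnGenerators T ∧ IsWeakAntipode Δ T := by
  refine ⟨WSl.typesOf_bijective n, fun d => ?_⟩
  obtain ⟨Δ, hΔ⟩ := WSl.exists_isCoproduct (d := WSl.typesOf n d) hq0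
  obtain ⟨ε, hε⟩ := WSl.exists_isCounit (d := WSl.typesOf n d) hq0
  obtain ⟨T, T_one, T_mul, hT⟩ := WSl.exists_isAntipodeOnGenerators (d := WSl.typesOf n d) hq0
  exact ⟨Δ, ε, T, hΔ, hε, hΔ.isBialgebra hε, hT, hT.isWeakAntipode hΔ hε T_one T_mul hq0⟩
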